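/- Let $M$ be a topological monoid and let $G$ be a locally compact Hausdorff topological group such that $M$ is (algebraically and topologically) isomorphic, via a monoid homomorphism $\iota : M \to G$ that is a homeomorphism onto a closed subset of $G$, to a closed submonoid of $G$. Suppose that $\iota(M)$ is positive in the identity, i.e. for every neighbourhood $U \subseteq G$ of the identity, the set $U \cap \iota(M)$ has non-empty interior in $G$. A semigroup over a (real or complex) Banach space $E$ on $M$ is a map $T : M \to B(E)$ into the bounded linear operators on $E$ with $T(1) = I$ and $T(st) = T(s)T(t)$ for all $s, t \in M$; no contractivity is assumed. It is WOT-continuous, respectively SOT-continuous, if it is continuous for the weak, respectively strong, operator topology on $B(E)$. The monoid $M$ is called good if for a separable infinite-dimensional Hilbert space $H$ (equivalently, for every such space, over the given scalar field) the set of WOT-continuous semigroups $T$ over $H$ on $M$ with $\|T(t)\| \le 1$ for all $t \in M$ coincides with the set of SOT-continuous ones. Then for every Banach space $E$, every WOT-continuous semigroup $T : M \to B(E)$ is SOT-continuous. In particular, $M$ is good. -/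

import Mathlib

open Topology

universe w w'

section SemigroupContinuity

/-- A semigroup over `E` on a monoid `M` is an operator-valued map with `T 1 = I` and
`T (s * t) = T s * T t` (composition of operators), i.e. a monoid morphism `M →* (E →L[𝕜] E)`.
It is WOT-continuous if it is continuous for the weak operator topology on `E →L[𝕜] E`. -/
def IsWOTContinuous {𝕜 : Type*} [RCLike 𝕜] {M : Type*} [Monoid M] [TopologicalSpace M]
    {E : Type*} [NormedAddCommGroup E] [NormedSpace 𝕜 E] (T : M →* (E →L[𝕜] E)) : Prop :=
  Continuous fun t : M => (ContinuousLinearMapWOT.ofCLM (T t) : E →WOT[𝕜] E)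

/-- A semigroup is SOT-continuous if it is continuous for the strong operator topology, the
topology of pointwise norm convergence on `E →L[𝕜] E`. -/
def IsSOTContinuous {𝕜 : Type*} [RCLike 𝕜] {M : Type*} [Monoid M] [TopologicalSpace M]
    {E : Type*} [NormedAddCommGroup E] [NormedSpace 𝕜 E] (T : M →* (E →L[𝕜] E)) : Prop :=
  Continuous fun t : M => ContinuousLinearMap.toPointwiseConvergenceCLM 𝕜 (RingHom.id 𝕜) E E (T t)

/-- The WOT-continuous contractive semigroups over `H` on `M`. -/
def contractiveWOTSemigroups (𝕜 : Type*) [RCLike 𝕜] (M : Type*) [Monoid M] [TopologicalSpace M]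
    (H : Type*) [NormedAddCommGroup H] [NormedSpace 𝕜 H] : Set (M →* (H →L[𝕜] H)) :=
  {T | (∀ t, ‖T t‖ ≤ 1) ∧ IsWOTContinuous T}

/-- The SOT-continuous contractive semigroups over `H` on `M`. -/
def contractiveSOTSemigroups (𝕜 : Type*) [RCLike 𝕜] (M : Type*) [Monoid M] [TopologicalSpace M]
    (H : Type*) [NormedAddCommGroup H] [NormedSpace 𝕜 H] : Set (M →* (H →L[𝕜] H)) :=
  {T | (∀ t, ‖T t‖ ≤ 1) ∧ IsSOTContinuous T}

/-- A topological monoid `M` is good if, over separable infinite-dimensional Hilbert spaces, the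
WOT-continuous contractive semigroups on `M` are exactly the SOT-continuous ones. -/
def IsGoodMonoid (𝕜 : Type*) [RCLike 𝕜] (M : Type*) [Monoid M] [TopologicalSpace M] :
    Prop :=
  ∀ (H : Type w) [NormedAddCommGroup H] [InnerProductSpace 𝕜 H] [CompleteSpace H]
    [TopologicalSpace.SeparableSpace H], ¬ FiniteDimensional 𝕜 H →
    contractiveWOTSemigroups 𝕜 M H = contractiveSOTSemigroups 𝕜 M H

/-- A subset `A` of a topological group is positive in the identity if `U ∩ A` has non-empty
interior for every neighbourhood `U` of the identity. -/
def PositiveInIdentity {G : Type*} [Group G] [TopologicalSpace G] (A : Set G) : Prop :=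
  ∀ U ∈ 𝓝 (1 : G), (interior (U ∩ A)).Nonempty

end SemigroupContinuity

open MeasureTheory Filter Set
open scoped Pointwise

/-! Average an orbit against Haar measure: `y = ∫ f(s) T(s)x ds`, with `f` a bump supported in the
interior of `ι(M)`. Invariance gives `T(t)y = ∫ f(t⁻¹s) T(s)x ds`, so L¹-continuity of translation
makes the orbit of `y` norm continuous (`exists_smoothed_vector`). Vectors with norm continuous
orbits form a closed subspace. A functional separating `x` from it would also separate `x` from
averages of `T(s)x` over `s` near 1, which positivity in the identity provides. The averages are
weak integrals that must lie in `E`, not just in its bidual. This Krein-type fact is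
`exists_forall_dual_eq_integral`, proved by an iterated-limit argument and dominated convergence. -/

/-! ### Duality and weak compactness in Banach spaces. -/

/-- **Goldstine's theorem**, for finitely many functionals on a real normed space. -/
theorem exists_norm_le_forall_abs_sub_lt {Y : Type*} [NormedAddCommGroup Y] [NormedSpace ℝ Y]
    (Ψ : StrongDual ℝ (StrongDual ℝ Y)) (F : Finset (StrongDual ℝ Y)) {ε : ℝ} (hε : 0 < ε) :
    ∃ y : Y, ‖y‖ ≤ ‖Ψ‖ ∧ ∀ f ∈ F, |f y - Ψ f| < ε := by
  classical
  have hN : 0 ≤ ‖Ψ‖ := Ψ.opNorm_nonneg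
  let L : Y →L[ℝ] (F → ℝ) := ContinuousLinearMap.pi fun f => (f : StrongDual ℝ Y)
  let v : F → ℝ := fun f => Ψ f
  have hconv : Convex ℝ (closure (L '' Metric.closedBall 0 ‖Ψ‖)) :=
    ((convex_closedBall (0 : Y) ‖Ψ‖).linear_image L.toLinearMap).closure
  by_cases hv : v ∈ closure (L '' Metric.closedBall 0 ‖Ψ‖)
  · obtain ⟨_, ⟨y, hy, rfl⟩, hd⟩ := Metric.mem_closure_iff.1 hv ε hε
    refine ⟨y, by simpa using hy, fun f hf => ?_⟩
    have h := (dist_pi_lt_iff hε).1 hd ⟨f, hf⟩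
    rwa [dist_comm, Real.dist_eq] at h
  · exfalso
    -- The separating functional on `F → ℝ` pulls back to `h` on `Y`. Being below `u` on the ball
    -- gives `‖Ψ‖ * ‖h‖ ≤ u < Ψ h`.
    obtain ⟨c, u, hcu, huv⟩ := geometric_hahn_banach_closed_point hconv isClosed_closure hv
    let h : StrongDual ℝ Y := ∑ f : F, c (Pi.single f 1) • (f : StrongDual ℝ Y)
    have hc : ∀ a : F → ℝ, c a = ∑ f : F, c (Pi.single f 1) * a f := fun a => by
      conv_lhs => rw [pi_eq_sum_univ' a, map_sum]
      refine Finset.sum_congr rfl fun f _ => ?_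
      rw [map_smul, smul_eq_mul, mul_comm]
    have hL : ∀ y, c (L y) = h y := fun y => by
      rw [hc]
      simp [h, L]
    have hΨ : c v = Ψ h := by
      rw [hc]
      simp [h, v]
    have hlt : ∀ y, ‖y‖ ≤ ‖Ψ‖ → h y < u := fun y hy => by
      rw [← hL]
      exact hcu _ (subset_closure ⟨y, by simpa using hy, rfl⟩)
    have hu : 0 < u := by simpa using hlt 0 (by simpa using hN)
    have hΨu : u < Ψ h := hΨ ▸ huv
    have hle : Ψ h ≤ ‖Ψ‖ * ‖h‖ := (le_abs_self _).trans (Ψ.le_opNorm h)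
    have hpos : 0 < ‖Ψ‖ := by
      by_contra h0
      have : ‖Ψ‖ = 0 := le_antisymm (not_lt.1 h0) hN
      rw [this, zero_mul] at hle
      linarith
    have hh : ‖h‖ ≤ u / ‖Ψ‖ := by
      refine ContinuousLinearMap.opNorm_le_of_unit_norm (by positivity) fun y hy => ?_
      rw [le_div_iff₀ hpos, Real.norm_eq_abs]
      have h1 := hlt (‖Ψ‖ • y) (by simp [norm_smul, hy, abs_of_nonneg hN])
      have h2 := hlt (-(‖Ψ‖ • y)) (by simp [norm_smul, hy, abs_of_nonneg hN])
      simp only [map_neg, map_smul, smul_eq_mul] at h1 h2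
      rcases abs_cases (h y) with ⟨h3, _⟩ | ⟨h3, _⟩ <;> rw [h3] <;> nlinarith
    rw [le_div_iff₀ hpos] at hh
    linarith [mul_comm ‖h‖ ‖Ψ‖]

/-- A weakly continuous map is bounded on compact sets. -/
theorem exists_forall_norm_le_of_continuousOn_dual {X E : Type*} [TopologicalSpace X]
    [NormedAddCommGroup E] [NormedSpace ℝ E] {K : Set X} (hK : IsCompact K) {g : X → E}
    (hg : ∀ ξ : StrongDual ℝ E, ContinuousOn (fun s => ξ (g s)) K) :
    ∃ C, 0 ≤ C ∧ ∀ s ∈ K, ‖g s‖ ≤ C := by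
  obtain ⟨C, hC⟩ := banach_steinhaus
    (g := fun s : K => NormedSpace.inclusionInDoubleDual ℝ E (g s)) fun ξ => by
      obtain ⟨C, hC⟩ := hK.exists_bound_of_continuousOn (hg ξ)
      exact ⟨C, fun s => hC s s.2⟩
  refine ⟨max C 0, le_max_right _ _, fun s hs => ?_⟩
  have h := hC ⟨s, hs⟩
  rw [show ‖NormedSpace.inclusionInDoubleDual ℝ E (g s)‖ = ‖g s‖ from
    (NormedSpace.inclusionInDoubleDualLi ℝ).norm_map (g s)] at h
  exact h.trans (le_max_left _ _)

/-- A compact space has finite nets for finitely many continuous functions at once. -/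
theorem exists_finset_net {X E : Type*} [TopologicalSpace X] [CompactSpace X]
    [NormedAddCommGroup E] [NormedSpace ℝ E] {g : X → E}
    (hg : ∀ ξ : StrongDual ℝ E, Continuous fun s => ξ (g s)) {ε : ℝ} (hε : 0 < ε)
    (A : Finset (StrongDual ℝ E)) :
    ∃ S : Finset X, ∀ s, ∃ s' ∈ S, ∀ ξ ∈ A, |ξ (g s') - ξ (g s)| < ε := by
  obtain ⟨S, -, hS⟩ := (isCompact_univ (X := X)).elim_nhds_subcover
    (fun s' => {s | ∀ ξ ∈ A, |ξ (g s') - ξ (g s)| < ε}) fun s' _ => by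
      refine (eventually_all_finset A).2 fun ξ _ => ?_
      have := (hg ξ).continuousAt.eventually (Metric.ball_mem_nhds (ξ (g s')) hε)
      filter_upwards [this] with s hs
      rwa [abs_sub_comm, ← Real.dist_eq]
  refine ⟨S, fun s => ?_⟩
  simpa using hS (mem_univ s)

/-- Two maps between finite sets and points produce a sequence by alternation. -/
theorem exists_seq_alternating {α β : Type*} (step : Finset β → α) (net : Finset α → Finset β) :
    ∃ (ξ : ℕ → α) (A : ℕ → Finset α) (T : ℕ → Finset β), (∀ n, ξ n = step (T n)) ∧
      (∀ i k, i ≤ k → ξ i ∈ A k) ∧ ∀ k n, k < n → net (A k) ⊆ T n := by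
  classical
  -- The state pairs the elements produced so far with the test points accumulated so far.
  let st : ℕ → Finset α × Finset β := fun n => Nat.rec (∅, ∅)
    (fun _ p => (insert (step p.2) p.1, p.2 ∪ net (insert (step p.2) p.1))) n
  have h1 : ∀ n, (st (n + 1)).1 = insert (step (st n).2) (st n).1 := fun _ => rfl
  have h2 : ∀ n, (st (n + 1)).2 = (st n).2 ∪ net (st (n + 1)).1 := fun _ => rfl
  have m1 : Monotone fun n => (st n).1 := monotone_nat_of_le_succ fun n => by
    simp only [h1]
    exact Finset.subset_insert _ _
  have m2 : Monotone fun n => (st n).2 := monotone_nat_of_le_succ fun n => by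
    simp only [h2]
    exact Finset.subset_union_left
  refine ⟨fun n => step (st n).2, fun k => (st (k + 1)).1, fun n => (st n).2, fun _ => rfl,
    fun i k hik => ?_, fun k n hkn => ?_⟩
  · refine m1 (Nat.succ_le_succ hik) ?_
    simp only [h1, Nat.succ_eq_add_one]
    exact Finset.mem_insert_self _ _
  · refine subset_trans ?_ (m2 (Nat.succ_le_of_lt hkn))
    simp only [h2, Nat.succ_eq_add_one]
    exact Finset.subset_union_right

/-- If a functional on the bidual separates `φ` from the weakly compact set `range g`, then it can
be replaced by a bounded sequence of functionals that pointwise separates `φ` from `range g`. -/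
theorem exists_seq_dual_separating {X E : Type*} [TopologicalSpace X] [CompactSpace X]
    [NormedAddCommGroup E] [NormedSpace ℝ E] {g : X → E}
    (hg : ∀ ξ : StrongDual ℝ E, Continuous fun s => ξ (g s))
    (Ψ : StrongDual ℝ (StrongDual ℝ (StrongDual ℝ E))) (φ : StrongDual ℝ (StrongDual ℝ E))
    {u u' u'' : ℝ} (hu : u < u')
    (hΨg : ∀ s, Ψ (NormedSpace.inclusionInDoubleDual ℝ E (g s)) < u) (hΨφ : u'' < Ψ φ) :
    ∃ (R : ℝ) (ξ : ℕ → StrongDual ℝ E), (∀ n, ‖ξ n‖ ≤ R) ∧ (∀ n, u'' < φ (ξ n)) ∧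
      ∀ s, ∀ᶠ n in atTop, ξ n (g s) < u' := by
  classical
  obtain ⟨R, hR⟩ : ∃ R : ℝ, ∀ (F : Finset (StrongDual ℝ (StrongDual ℝ E))) (ε : ℝ), 0 < ε →
      ∃ ξ : StrongDual ℝ E, ‖ξ‖ ≤ R ∧ ∀ f ∈ F, |f ξ - Ψ f| < ε :=
    ⟨_, fun F _ hε => exists_norm_le_forall_abs_sub_lt Ψ F hε⟩
  have hstep : ∀ T : Finset X, ∃ ξ : StrongDual ℝ E, ‖ξ‖ ≤ R ∧ u'' < φ ξ ∧
      ∀ s ∈ T, ξ (g s) < u := fun T => by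
    have hpos : ∀ T : Finset X, ∃ ε, 0 < ε ∧ ε ≤ Ψ φ - u'' ∧
        ∀ s ∈ T, ε ≤ u - Ψ (NormedSpace.inclusionInDoubleDual ℝ E (g s)) := fun T => by
      induction T using Finset.induction_on with
      | empty => exact ⟨Ψ φ - u'', sub_pos.2 hΨφ, le_rfl, by simp⟩
      | insert a T _ ih =>
        obtain ⟨ε, h0, h1, h2⟩ := ih
        refine ⟨min ε (u - Ψ (NormedSpace.inclusionInDoubleDual ℝ E (g a))),
          lt_min h0 (sub_pos.2 (hΨg a)), (min_le_left _ _).trans h1, fun s hs => ?_⟩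
        rcases Finset.mem_insert.1 hs with rfl | hs
        · exact min_le_right _ _
        · exact (min_le_left _ _).trans (h2 s hs)
    obtain ⟨ε, h0, h1, h2⟩ := hpos T
    obtain ⟨ξ, hξ, hF⟩ := hR
      (insert φ (T.image fun s => NormedSpace.inclusionInDoubleDual ℝ E (g s))) ε h0
    refine ⟨ξ, hξ, ?_, fun s hs => ?_⟩
    · have := abs_lt.1 (hF φ (Finset.mem_insert_self _ _))
      linarith
    · have := abs_lt.1 (hF _ (Finset.mem_insert_of_mem (Finset.mem_image_of_mem _ hs)))
      rw [NormedSpace.dual_def] at this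
      linarith [h2 s hs]
  choose step hs1 hs2 hs3 using hstep
  have hε : 0 < (u' - u) / 2 := by linarith
  choose net hnet using exists_finset_net hg hε
  obtain ⟨ξ, A, T, hξ, hA, hT⟩ := exists_seq_alternating step net
  refine ⟨R, ξ, fun n => hξ n ▸ hs1 _, fun n => hξ n ▸ hs2 _, fun s => ?_⟩
  -- Interchange of limits. By construction `ξ n (g (σ k)) ≤ u` for `k < n`, so `n → ∞` and then `k
  -- → ∞` give `η (g t) ≤ u`. The nets make `t` and `s` nearly indistinguishable by every `ξ i`, so
  -- `η (g t)` is also at least the midpoint of `u` and `u'`.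
  by_contra hfreq
  have hfreq' : ∃ᶠ n in atTop, u' ≤ ξ n (g s) := by
    simpa [Filter.Frequently, not_le] using hfreq
  choose σ hσ hσs using fun k => hnet (A k) s
  -- a cluster point of the net points near `s`
  obtain ⟨V, hV⟩ : ∃ V : Ultrafilter ℕ, (V : Filter ℕ) ≤ atTop := ⟨_, Ultrafilter.of_le atTop⟩
  obtain ⟨t, -, ht⟩ := isCompact_univ.ultrafilter_le_nhds (V.map σ) (by simp)
  have hlimt : ∀ η : StrongDual ℝ E, Tendsto (fun k => η (g (σ k))) V (𝓝 (η (g t))) :=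
    fun η => ((hg η).tendsto t).comp ht
  have hnear : ∀ i, |ξ i (g t) - ξ i (g s)| ≤ (u' - u) / 2 := fun i => by
    refine le_of_tendsto ((hlimt (ξ i)).sub_const _).abs (hV ?_)
    filter_upwards [eventually_ge_atTop i] with k hk
    exact (hσs k _ (hA i k hk)).le
  -- a weak-star cluster point of the functionals
  have : (atTop ⊓ 𝓟 {n | u' ≤ ξ n (g s)}).NeBot := frequently_mem_iff_neBot.1 hfreq'
  obtain ⟨W, hW⟩ : ∃ W : Ultrafilter ℕ, (W : Filter ℕ) ≤ atTop ⊓ 𝓟 {n | u' ≤ ξ n (g s)} :=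
    ⟨_, Ultrafilter.of_le _⟩
  obtain ⟨η, -, hη⟩ := (WeakDual.isCompact_closedBall (𝕜 := ℝ) (0 : StrongDual ℝ E)
    R).ultrafilter_le_nhds (W.map fun n => StrongDual.toWeakDual (ξ n)) (by
      rw [le_principal_iff]
      refine Filter.Eventually.of_forall (f := (W : Filter ℕ)) fun n => ?_
      simpa using hξ n ▸ hs1 _)
  have hlimη : ∀ x : E, Tendsto (fun n => ξ n x) W (𝓝 (η x)) := fun x =>
    ((WeakDual.eval_continuous x).tendsto η).comp hη
  have hle : ∀ k, η (g (σ k)) ≤ u := fun k => by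
    refine le_of_tendsto (hlimη _) ((hW.trans inf_le_left) ?_)
    filter_upwards [eventually_gt_atTop k] with n hn
    rw [hξ n]
    exact (hs3 _ _ (hT k n hn (hσ k))).le
  have h1 : η (g t) ≤ u :=
    le_of_tendsto (hlimt (WeakDual.toStrongDual η)) (Filter.Eventually.of_forall hle)
  have h2 : u' - (u' - u) / 2 ≤ η (g t) := by
    refine ge_of_tendsto (hlimη _) ((hW.trans inf_le_right) ?_)
    rw [mem_principal]
    intro n hn
    have := abs_le.1 (hnear n)
    have hn' : u' ≤ ξ n (g s) := hn
    show u' - (u' - u) / 2 ≤ ξ n (g t)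
    linarith
  linarith

/-! ### Barycentres and weak integrals. -/

/-- A weakly continuous map from a compact space into a Banach space has a barycentre with respect
to every probability measure. -/
theorem exists_forall_dual_eq_integral {X E : Type*} [TopologicalSpace X] [CompactSpace X]
    [MeasurableSpace X] [OpensMeasurableSpace X] [NormedAddCommGroup E] [NormedSpace ℝ E]
    [CompleteSpace E] (P : Measure X) [IsProbabilityMeasure P] {g : X → E}
    (hg : ∀ ξ : StrongDual ℝ E, Continuous fun s => ξ (g s)) :
    ∃ x : E, ∀ ξ : StrongDual ℝ E, ξ x = ∫ s, ξ (g s) ∂P := by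
  obtain ⟨C, hC0, hC⟩ := exists_forall_norm_le_of_continuousOn_dual isCompact_univ
    fun ξ => (hg ξ).continuousOn (s := univ)
  have hbound : ∀ (ξ : StrongDual ℝ E) s, ‖ξ (g s)‖ ≤ C * ‖ξ‖ := fun ξ s =>
    (ξ.le_opNorm _).trans (by
      rw [mul_comm]
      exact mul_le_mul_of_nonneg_right (hC s (mem_univ s)) (norm_nonneg ξ))
  have hint : ∀ ξ : StrongDual ℝ E, Integrable (fun s => ξ (g s)) P := fun ξ =>
    Integrable.of_bound (hg ξ).aestronglyMeasurable _ (Eventually.of_forall (hbound ξ))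
  let φ : StrongDual ℝ (StrongDual ℝ E) := LinearMap.mkContinuous
    { toFun := fun ξ => ∫ s, ξ (g s) ∂P
      map_add' := fun ξ η => integral_add (hint ξ) (hint η)
      map_smul' := fun c ξ => integral_const_mul c _ } C fun ξ => by
        refine (norm_integral_le_of_norm_le_const (Eventually.of_forall (hbound ξ))).trans ?_
        simp
  have hφ : ∀ ξ, φ ξ = ∫ s, ξ (g s) ∂P := fun _ => rfl
  let J := NormedSpace.inclusionInDoubleDualLi ℝ (E := E)
  have hclosed : IsClosed (range J) := by
    have h : IsComplete (range J) := J.isometry.isUniformInducing.isComplete_range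
    exact h.isClosed
  suffices h : φ ∈ range J by
    obtain ⟨x, hx⟩ := h
    exact ⟨x, fun ξ => by rw [← hφ, ← hx]; rfl⟩
  have hsub : closure (convexHull ℝ (range fun s => J (g s))) ⊆ range J := by
    refine closure_minimal (convexHull_min ?_ ?_) hclosed
    · rintro _ ⟨s, rfl⟩
      exact mem_range_self _
    · exact (LinearMap.range J.toLinearMap).convex
  refine hsub ?_
  by_contra hnot
  obtain ⟨Ψ, u, hΨu, huφ⟩ := geometric_hahn_banach_closed_point
    (convex_convexHull ℝ (range fun s => J (g s))).closure isClosed_closure hnot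
  obtain ⟨u'', hu'', hu''φ⟩ := exists_between huφ
  obtain ⟨u', hu', hu'u''⟩ := exists_between hu''
  obtain ⟨R, ξ, hξR, hξφ, hξ⟩ := exists_seq_dual_separating hg Ψ φ hu'
    (fun s => hΨu _ (subset_closure (subset_convexHull ℝ _ (mem_range_self s)))) hu''φ
  -- The positive parts of `ξ n ∘ g - u'` are uniformly bounded and eventually vanish at each point,
  -- yet their integrals stay above `u'' - u' > 0`.
  have hcont : ∀ n, Continuous fun s => max (ξ n (g s) - u') 0 := fun n =>
    ((hg _).sub continuous_const).max continuous_const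
  have hb : ∀ n s, ‖max (ξ n (g s) - u') 0‖ ≤ C * R + |u'| := fun n s => by
    have h1 : ‖ξ n (g s)‖ ≤ C * R :=
      (hbound _ s).trans (mul_le_mul_of_nonneg_left (hξR n) hC0)
    rw [Real.norm_of_nonneg (le_max_right _ _)]
    have h2 := (abs_le.1 (Real.norm_eq_abs _ ▸ h1)).2
    have h3 := neg_abs_le u'
    have h4 := abs_nonneg u'
    have h5 := (norm_nonneg _).trans h1
    exact max_le (by linarith) (by linarith)
  have hlim : Tendsto (fun n => ∫ s, max (ξ n (g s) - u') 0 ∂P) atTop (𝓝 (∫ _, (0 : ℝ) ∂P)) := by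
    refine tendsto_integral_of_dominated_convergence (fun _ => C * R + |u'|)
      (fun n => (hcont n).aestronglyMeasurable) (integrable_const _)
      (fun n => Eventually.of_forall (hb n)) (Eventually.of_forall fun s => ?_)
    refine tendsto_const_nhds.congr' ?_
    filter_upwards [hξ s] with n hn
    rw [max_eq_right (by linarith)]
  have hge : ∀ n, u'' - u' ≤ ∫ s, max (ξ n (g s) - u') 0 ∂P := fun n => by
    have h1 : ∫ s, (ξ n (g s) - u') ∂P = φ (ξ n) - u' := by
      rw [integral_sub (hint _) (integrable_const _)]
      simp [hφ]
    have h2 : ∫ s, (ξ n (g s) - u') ∂P ≤ ∫ s, max (ξ n (g s) - u') 0 ∂P :=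
      integral_mono ((hint _).sub (integrable_const _))
        (Integrable.of_bound (hcont n).aestronglyMeasurable _ (Eventually.of_forall (hb n)))
        fun s => le_max_left _ _
    linarith [hξφ n]
  have := ge_of_tendsto' hlim hge
  simp at this
  linarith

/-- A weakly continuous map into a Banach space has a weak integral against a probability density
that vanishes off a compact set. -/
theorem exists_forall_dual_eq_integral_mul {X E : Type*} [TopologicalSpace X] [T2Space X]
    [MeasurableSpace X] [BorelSpace X] [NormedAddCommGroup E] [NormedSpace ℝ E]
    [CompleteSpace E] (μ : Measure X) {f : X → ℝ} (hf : Continuous f) (hf0 : 0 ≤ f)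
    (hf1 : ∫ s, f s ∂μ = 1) {K : Set X} (hK : IsCompact K) (hfK : ∀ s ∉ K, f s = 0) {g : X → E}
    (hg : ∀ ξ : StrongDual ℝ E, ContinuousOn (fun s => ξ (g s)) K) :
    ∃ x : E, ∀ ξ : StrongDual ℝ E, ξ x = ∫ s, f s * ξ (g s) ∂μ := by
  have hKm : MeasurableSet K := hK.measurableSet
  have hfi : Integrable f μ := by
    by_contra h
    rw [integral_undef h] at hf1
    exact zero_ne_one hf1
  have hfm : Measurable fun s => ENNReal.ofReal (f s) := hf.measurable.ennreal_ofReal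
  have : CompactSpace K := isCompact_iff_compactSpace.1 hK
  let ν := μ.withDensity fun s => ENNReal.ofReal (f s)
  have hν : IsProbabilityMeasure (ν.comap ((↑) : K → X)) := ⟨by
    rw [Measure.comap_apply _ Subtype.val_injective
      (fun s hs => hKm.subtype_image hs) _ MeasurableSet.univ, image_univ, Subtype.range_coe,
      withDensity_apply _ hKm, ← ofReal_integral_eq_lintegral_ofReal hfi.integrableOn
        (Eventually.of_forall hf0), setIntegral_eq_integral_of_forall_compl_eq_zero hfK, hf1,
      ENNReal.ofReal_one]⟩
  obtain ⟨x, hx⟩ := exists_forall_dual_eq_integral (ν.comap ((↑) : K → X))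
    (g := fun s : K => g s) fun ξ => continuousOn_iff_continuous_domRestrict.1 (hg ξ)
  refine ⟨x, fun ξ => ?_⟩
  rw [hx, integral_subtype_comap hKm fun s => ξ (g s), restrict_withDensity hKm,
    integral_withDensity_eq_integral_toReal_smul hfm (Eventually.of_forall fun _ =>
      ENNReal.ofReal_lt_top)]
  simp only [ENNReal.toReal_ofReal (hf0 _), smul_eq_mul]
  exact setIntegral_eq_integral_of_forall_compl_eq_zero fun s hs => by rw [hfK s hs, zero_mul]

/-- Extension by zero along a closed embedding is weakly continuous on the range. -/
theorem continuousOn_range_extend {M G E : Type*} [TopologicalSpace M] [TopologicalSpace G]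
    [NormedAddCommGroup E] [NormedSpace ℝ E] {ι : M → G} (hι : IsClosedEmbedding ι) {h : M → E}
    {ξ : StrongDual ℝ E} (hh : Continuous fun t => ξ (h t)) :
    ContinuousOn (fun s => ξ (Function.extend ι h 0 s)) (range ι) := by
  rintro _ ⟨m, rfl⟩
  rw [ContinuousWithinAt, ← hι.isEmbedding.map_nhds_eq, tendsto_map'_iff]
  simpa [Function.comp_def, hι.injective.extend_apply] using hh.tendsto m

/-! ### Smoothing of orbits over real scalars. -/

section RealSemigroup

variable {M : Type*} [Monoid M] [TopologicalSpace M] {G : Type*} [Group G] [TopologicalSpace G]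
  [IsTopologicalGroup G] [LocallyCompactSpace G] [T2Space G] {E : Type*} [NormedAddCommGroup E]
  [NormedSpace ℝ E] [CompleteSpace E]

/-- Smoothing an orbit of a weakly continuous semigroup over the interior of the monoid gives
vectors with norm continuous orbits. -/
theorem exists_smoothed_vector [MeasurableSpace G] [BorelSpace G] (μ : Measure G)
    [μ.IsHaarMeasure] (ι : M →* G) (hι : IsClosedEmbedding ι) (T : M →* (E →L[ℝ] E))
    (hT : ∀ (x : E) (ξ : StrongDual ℝ E), Continuous fun t => ξ (T t x)) (x : E)
    {f : G → ℝ} (hf : Continuous f) (hfc : HasCompactSupport f) (hf0 : 0 ≤ f)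
    (hf1 : ∫ s, f s ∂μ = 1) (hfA : tsupport f ⊆ interior (range ι)) :
    ∃ y : E, (∀ ξ : StrongDual ℝ E,
        Integrable (fun s => f s * ξ (Function.extend ι (fun t => T t x) 0 s)) μ ∧
        ξ y = ∫ s, f s * ξ (Function.extend ι (fun t => T t x) 0 s) ∂μ) ∧
      Continuous fun t => T t y := by
  set g : G → E := Function.extend ι (fun t => T t x) 0 with hgdef
  have hgι : ∀ m, g (ι m) = T m x := fun m => hι.injective.extend_apply _ _ _
  have hgA : ∀ ξ : StrongDual ℝ E, ContinuousOn (fun s => ξ (g s)) (range ι) := fun ξ =>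
    continuousOn_range_extend hι (hT x ξ)
  have hfA' : tsupport f ⊆ range ι := hfA.trans interior_subset
  obtain ⟨y, hy⟩ := exists_forall_dual_eq_integral_mul μ hf hf0 hf1 hfc
    (fun s hs => image_eq_zero_of_notMem_tsupport hs) fun ξ => (hgA ξ).mono hfA'
  have hint : ∀ ξ : StrongDual ℝ E, Integrable (fun s => f s * ξ (g s)) μ := fun ξ => by
    refine Continuous.integrable_of_hasCompactSupport ?_ hfc.mul_right
    refine continuous_of_tsupport fun s hs => hf.continuousAt.mul ?_
    exact (hgA ξ).continuousAt (mem_interior_iff_mem_nhds.1 (hfA (tsupport_mul_subset_left hs)))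
  have htrans : ∀ (t : M) (ξ : StrongDual ℝ E) (s : G),
      f s * ξ (T t (g s)) = f s * ξ (g (ι t * s)) := fun t ξ s => by
    by_cases hs : s ∈ tsupport f
    · obtain ⟨m, rfl⟩ := hfA' hs
      rw [hgι, ← map_mul, hgι, map_mul]
      rfl
    · simp [image_eq_zero_of_notMem_tsupport hs]
  have hint' : ∀ (t : M) (ξ : StrongDual ℝ E),
      Integrable (fun s => f ((ι t)⁻¹ * s) * ξ (g s)) μ := fun t ξ => by
    have h := (hint (ξ.comp (T t))).comp_mul_left (ι t)⁻¹
    simp only [ContinuousLinearMap.comp_apply, htrans, mul_inv_cancel_left] at h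
    exact h
  -- Left invariance moves the action of `t` from the orbit to the density.
  have hTy : ∀ (t : M) (ξ : StrongDual ℝ E),
      ξ (T t y) = ∫ s, f ((ι t)⁻¹ * s) * ξ (g s) ∂μ := fun t ξ => by
    have h := hy (ξ.comp (T t))
    simp only [ContinuousLinearMap.comp_apply, htrans] at h
    rw [h, ← integral_mul_left_eq_self (fun s => f ((ι t)⁻¹ * s) * ξ (g s)) (ι t)]
    simp only [inv_mul_cancel_left]
  refine ⟨y, fun ξ => ⟨hint ξ, hy ξ⟩, continuous_iff_continuousAt.2 fun t₀ => ?_⟩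
  obtain ⟨N, hN, hNt⟩ := exists_compact_mem_nhds (ι t₀)
  have ht₀N : ι t₀ ∈ N := mem_of_mem_nhds hNt
  have hk : IsCompact (N * tsupport f) := hN.mul hfc
  have hfk : ∀ p ∈ N, ∀ s ∉ N * tsupport f, f (p⁻¹ * s) = 0 := fun p hp s hs =>
    image_eq_zero_of_notMem_tsupport fun h => hs ⟨p, hp, _, h, by simp⟩
  obtain ⟨C, hC0, hC⟩ := exists_forall_norm_le_of_continuousOn_dual
    (hk.inter_right hι.isClosed_range) fun ξ => (hgA ξ).mono inter_subset_right
  have hC' : ∀ s ∈ N * tsupport f, ‖g s‖ ≤ C := fun s hs => by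
    by_cases hsA : s ∈ range ι
    · exact hC s ⟨hs, hsA⟩
    · rw [hgdef, Function.extend_apply' _ _ _ fun ⟨m, hm⟩ => hsA ⟨m, hm⟩]
      simpa using hC0
  let Φ : G → ℝ := fun p => ∫ s, |f (p⁻¹ * s) - f ((ι t₀)⁻¹ * s)| ∂μ
  have hΦ : ContinuousOn Φ N := by
    refine continuousOn_integral_of_compact_support hk ?_ fun p s hp hs => ?_
    · refine Continuous.continuousOn ?_
      simp only [Function.uncurry_def]
      fun_prop
    · simp [hfk p hp s hs, hfk _ ht₀N s hs]
  have hdiff : ∀ t, ι t ∈ N → ‖T t y - T t₀ y‖ ≤ C * Φ (ι t) := fun t ht => by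
    have hΦ0 : 0 ≤ Φ (ι t) := integral_nonneg fun _ => abs_nonneg _
    refine NormedSpace.norm_le_dual_bound ℝ _ (mul_nonneg hC0 hΦ0) fun ξ => ?_
    have hΦi : Integrable (fun s => |f ((ι t)⁻¹ * s) - f ((ι t₀)⁻¹ * s)|) μ := by
      refine Continuous.integrable_of_hasCompactSupport (by fun_prop) ?_
      exact HasCompactSupport.intro hk fun s hs => by simp [hfk _ ht s hs, hfk _ ht₀N s hs]
    rw [map_sub, hTy, hTy, ← integral_sub (hint' t ξ) (hint' t₀ ξ)]
    calc ‖∫ s, (f ((ι t)⁻¹ * s) * ξ (g s) - f ((ι t₀)⁻¹ * s) * ξ (g s)) ∂μ‖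
        ≤ ∫ s, C * ‖ξ‖ * |f ((ι t)⁻¹ * s) - f ((ι t₀)⁻¹ * s)| ∂μ := by
          refine norm_integral_le_of_norm_le (hΦi.const_mul _) (Eventually.of_forall fun s => ?_)
          rw [← sub_mul, norm_mul, Real.norm_eq_abs, mul_comm]
          by_cases hs : s ∈ N * tsupport f
          · refine mul_le_mul_of_nonneg_right ((ξ.le_opNorm _).trans ?_) (abs_nonneg _)
            rw [mul_comm]
            exact mul_le_mul_of_nonneg_right (hC' s hs) (norm_nonneg ξ)
          · simp [hfk _ ht s hs, hfk _ ht₀N s hs]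
      _ = C * Φ (ι t) * ‖ξ‖ := by
          rw [integral_const_mul]
          ring
  have hlim : Tendsto (fun t => C * Φ (ι t)) (𝓝 t₀) (𝓝 0) := by
    have h0 : C * Φ (ι t₀) = 0 := by simp [Φ]
    rw [← h0]
    exact ((hΦ.continuousAt hNt).tendsto.comp (hι.continuous.tendsto t₀)).const_mul C
  rw [ContinuousAt, tendsto_iff_norm_sub_tendsto_zero]
  refine squeeze_zero' (Eventually.of_forall fun _ => norm_nonneg _) ?_ hlim
  filter_upwards [hι.continuous.continuousAt hNt] with t ht using hdiff t ht

/-- The vectors whose orbits are norm continuous. -/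
def continuousOrbitSubmodule (T : M →* (E →L[ℝ] E)) : Submodule ℝ E where
  carrier := {x | Continuous fun t => T t x}
  add_mem' hx hy := by simpa using! hx.add hy
  zero_mem' := by simpa using! continuous_const
  smul_mem' c _ hx := by simpa using! hx.const_smul c

theorem isClosed_continuousOrbitSubmodule [LocallyCompactSpace M] (T : M →* (E →L[ℝ] E))
    (hT : ∀ (x : E) (ξ : StrongDual ℝ E), Continuous fun t => ξ (T t x)) :
    IsClosed (continuousOrbitSubmodule T : Set E) := by
  refine isClosed_of_closure_subset fun x hx => continuous_iff_continuousAt.2 fun t₀ => ?_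
  obtain ⟨N, hN, hNt⟩ := exists_compact_mem_nhds t₀
  obtain ⟨C, hC⟩ := banach_steinhaus (g := fun t : N => T t) fun z => by
    obtain ⟨C, -, hC⟩ := exists_forall_norm_le_of_continuousOn_dual hN
      fun ξ => (hT z ξ).continuousOn
    exact ⟨C, fun t => hC t t.2⟩
  have hC0 : 0 ≤ C := (norm_nonneg _).trans (hC ⟨t₀, mem_of_mem_nhds hNt⟩)
  refine continuousAt_of_locally_uniform_approx_of_continuousAt fun u hu => ?_
  obtain ⟨ε, hε, hεu⟩ := Metric.mem_uniformity_dist.1 hu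
  obtain ⟨y, hy, hxy⟩ := Metric.mem_closure_iff.1 hx (ε / (C + 1)) (by positivity)
  refine ⟨N, hNt, fun t => T t y, Continuous.continuousAt hy, fun t ht => hεu ?_⟩
  rw [dist_eq_norm, ← map_sub]
  rw [dist_eq_norm, lt_div_iff₀ (by positivity)] at hxy
  calc ‖T t (x - y)‖ ≤ C * ‖x - y‖ := (T t).le_of_opNorm_le (hC ⟨t, ht⟩) _
    _ ≤ ‖x - y‖ * (C + 1) := by nlinarith [norm_nonneg (x - y)]
    _ < ε := hxy

/-- Weakly continuous semigroups over a real Banach space are strongly continuous. -/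
theorem continuous_orbit_of_weakly_continuous (ι : M →* G) (hι : IsClosedEmbedding ι)
    (hpos : PositiveInIdentity (range ι)) (T : M →* (E →L[ℝ] E))
    (hT : ∀ (x : E) (ξ : StrongDual ℝ E), Continuous fun t => ξ (T t x)) (x : E) :
    Continuous fun t => T t x := by
  have : LocallyCompactSpace M := hι.locallyCompactSpace
  borelize G
  let μ : Measure G := Measure.haar
  by_contra hx
  obtain ⟨ξ, u, hξx, hξD⟩ := geometric_hahn_banach_point_closed
    (continuousOrbitSubmodule T).convex (isClosed_continuousOrbitSubmodule T hT)
    (show x ∉ (continuousOrbitSubmodule T : Set E) from hx)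
  have hg := continuousOn_range_extend hι (hT x ξ)
  set g : G → E := Function.extend ι (fun t => T t x) 0
  have hg1 : g 1 = x := by
    have h : g (ι 1) = T 1 x := hι.injective.extend_apply _ _ _
    simpa using h
  -- Near 1 the orbit stays in the open half-space containing `x`. The bump sits at an interior
  -- point `p`, possibly different from 1.
  have hU : {s | s ∈ range ι → ξ (g s) < u} ∈ 𝓝 (1 : G) := by
    have h := hg 1 ⟨1, map_one ι⟩
    exact eventually_nhdsWithin_iff.1 (h.eventually_lt_const (by
      beta_reduce
      rwa [hg1]))
  obtain ⟨p, hp⟩ := hpos _ hU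
  obtain ⟨f, hfp, hfc, hfV, hf01⟩ := exists_continuousMap_one_of_isCompact_subset_isOpen
    (isCompact_singleton (x := p)) isOpen_interior (singleton_subset_iff.2 hp)
  have hfp' : f p ≠ 0 := by simp [hfp (mem_singleton p)]
  have hfI : 0 < ∫ s, f s ∂μ := f.continuous.integral_pos_of_hasCompactSupport_nonneg_nonzero hfc
    (fun s => (hf01 s).1) hfp'
  let c : ℝ := (∫ s, f s ∂μ)⁻¹
  have hc : 0 < c := inv_pos.2 hfI
  have hsupp : tsupport (fun s => c * f s) ⊆ tsupport f := tsupport_mul_subset_right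
  have hF1 : ∫ s, c * f s ∂μ = 1 := by
    rw [integral_const_mul]
    exact inv_mul_cancel₀ hfI.ne'
  have hFc : HasCompactSupport fun s => c * f s := HasCompactSupport.mul_left hfc
  obtain ⟨y, hy, hyc⟩ := exists_smoothed_vector μ ι hι T hT x
    (f := fun s => c * f s) (by fun_prop) hFc
    (fun s => mul_nonneg hc.le (hf01 s).1) hF1
    (hsupp.trans (hfV.trans (interior_mono inter_subset_right)))
  have hle : ξ y ≤ u := by
    rw [(hy ξ).2]
    calc ∫ s, c * f s * ξ (g s) ∂μ ≤ ∫ s, c * f s * u ∂μ := by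
          refine integral_mono (hy ξ).1 (Integrable.mul_const
            (Continuous.integrable_of_hasCompactSupport (by fun_prop) hFc) u) fun s => ?_
          by_cases hs : s ∈ tsupport f
          · have h := interior_subset (hfV hs)
            exact mul_le_mul_of_nonneg_left (h.1 h.2).le (mul_nonneg hc.le (hf01 s).1)
          · simp [image_eq_zero_of_notMem_tsupport hs]
      _ = u := by rw [integral_mul_const, hF1, one_mul]
  exact (hξD y hyc).not_ge hle

end RealSemigroup

/-! ### Operator topologies and general scalars. -/

/-- Weak operator continuity is continuity of all matrix coefficients. -/
theorem isWOTContinuous_iff {𝕜 : Type*} [RCLike 𝕜] {M : Type*} [Monoid M] [TopologicalSpace M]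
    {E : Type*} [NormedAddCommGroup E] [NormedSpace 𝕜 E] {T : M →* (E →L[𝕜] E)} :
    IsWOTContinuous T ↔ ∀ (x : E) (ξ : StrongDual 𝕜 E), Continuous fun t => ξ (T t x) :=
  ⟨fun h x ξ => (ContinuousLinearMapWOT.continuous_dual_apply x ξ).comp h,
    fun h => ContinuousLinearMapWOT.continuous_of_dual_apply_continuous h⟩

/-- Strong operator continuity is norm continuity of all orbits. -/
theorem isSOTContinuous_iff {𝕜 : Type*} [RCLike 𝕜] {M : Type*} [Monoid M] [TopologicalSpace M]
    {E : Type*} [NormedAddCommGroup E] [NormedSpace 𝕜 E] {T : M →* (E →L[𝕜] E)} :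
    IsSOTContinuous T ↔ ∀ x : E, Continuous fun t => T t x := by
  rw [IsSOTContinuous, (PointwiseConvergenceCLM.isEmbedding_coeFn _ E E).continuous_iff,
    continuous_pi_iff]
  rfl

theorem IsSOTContinuous.isWOTContinuous {𝕜 : Type*} [RCLike 𝕜] {M : Type*} [Monoid M]
    [TopologicalSpace M] {E : Type*} [NormedAddCommGroup E] [NormedSpace 𝕜 E]
    {T : M →* (E →L[𝕜] E)} (h : IsSOTContinuous T) : IsWOTContinuous T :=
  isWOTContinuous_iff.2 fun x ξ => ξ.continuous.comp (isSOTContinuous_iff.1 h x)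

/-- Reduces to real scalars: every real functional is the real part of a `𝕜`-linear one, and norm
continuity of orbits does not depend on the scalar field. -/
theorem IsWOTContinuous.isSOTContinuous {𝕜 : Type*} [RCLike 𝕜] {M : Type*} [Monoid M]
    [TopologicalSpace M] {G : Type*} [Group G] [TopologicalSpace G] [IsTopologicalGroup G]
    [LocallyCompactSpace G] [T2Space G] (ι : M →* G) (hι : IsClosedEmbedding ι)
    (hpos : PositiveInIdentity (range ι)) {E : Type*} [NormedAddCommGroup E] [NormedSpace 𝕜 E]
    [CompleteSpace E] {T : M →* (E →L[𝕜] E)} (h : IsWOTContinuous T) : IsSOTContinuous T := by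
  let _ : NormedSpace ℝ E := NormedSpace.restrictScalars ℝ 𝕜 E
  let S : M →* (E →L[ℝ] E) :=
    { toFun := fun t => (T t).restrictScalars ℝ
      map_one' := by ext; simp
      map_mul' := fun s t => by ext; simp }
  rw [isWOTContinuous_iff] at h
  refine isSOTContinuous_iff.2 fun x => continuous_orbit_of_weakly_continuous ι hι hpos S
    (fun z ξ => ?_) x
  have := RCLike.continuous_re.comp (h z (ξ.extendRCLike))
  simp only [Function.comp_def, StrongDual.re_extendRCLike_apply] at this
  exact this

theorem mainTheorem3 {𝕜 : Type*} [RCLike 𝕜]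
    {M : Type*} [Monoid M] [TopologicalSpace M] [ContinuousMul M]
    {G : Type*} [Group G] [TopologicalSpace G] [IsTopologicalGroup G]
    [LocallyCompactSpace G] [T2Space G]
    (ι : M →* G) (hι : IsClosedEmbedding ι) (hpos : PositiveInIdentity (Set.range ι)) :
    (∀ (E : Type w) [NormedAddCommGroup E] [NormedSpace 𝕜 E] [CompleteSpace E]
      (T : M →* (E →L[𝕜] E)), IsWOTContinuous T → IsSOTContinuous T) ∧
    IsGoodMonoid.{w'} 𝕜 M := by
  refine ⟨fun E _ _ _ T hT => hT.isSOTContinuous ι hι hpos, fun H _ _ _ _ _ => ?_⟩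
  ext T
  exact and_congr_right fun _ =>
    ⟨fun hT => hT.isSOTContinuous ι hι hpos, fun hT => hT.isWOTContinuous⟩
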